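/- Admission control to minimize rejections, unweighted case. Let $G=(V,E)$ be a directed graph with $m=|E|\ge 2$ edges (parallel edges are allowed) and integer capacities $c_e>0$, and let $c=\max_{e\in E}c_e$. Requests $r_1,r_2,\dots$, each of which is a simple path in $G$ and has cost $1$, arrive one at a time. A set of accepted requests is feasible if every edge $e$ lies on the paths of at most $c_e$ of them. Each request is accepted or rejected on arrival; an accepted request may be rejected later, but a rejected request cannot be accepted again. For the first $T$ requests, $C_{OPT}(T)$ is the minimum number of requests rejected by a feasible solution. Below, $\log$ is the natural logarithm. Consider the following randomized online algorithm. It keeps a weight $f_i\ge 0$ for each request, initially $0$. At any time, for an edge $e$, let $ALIVE_e$ be the set of requests $r_i$ that have arrived, whose paths contain $e$, and for which $f_i<1$; let $n_e=|ALIVE_e|-c_e$. When $r_t$ arrives: 1. For each edge $e$ of the path of $r_t$, one after the other in an arbitrary order (which does not depend on the random choices), while $\sum_{i\in ALIVE_e}f_i<n_e$, perform a weight augmentation: for each $i\in ALIVE_e$ with $f_i=0$ set $f_i=1/c$; then replace $f_i$ by $f_i(1+1/n_e)$ for each $i\in ALIVE_e$; then update $ALIVE_e$ and $n_e$. 2.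 Reject all requests whose weight is at least $1/(4\log m)$. 3. For each request, if its weight increased by $\delta$ in step 1 of this round, reject it with probability $\min\{1,4\delta\log m\}$, all these random choices being independent. 4. If $r_t$ has not been rejected in steps 2 and 3, then reject it if accepting it would make some edge exceed its capacity, and accept it otherwise. Theorem. There is an absolute constant $K>0$ such that for every such network, every fixed sequence of requests, every choice of the orders in step 1 and every $T\ge 0$, the set of accepted requests after $T$ requests is feasible, requests that have been rejected stay rejected, and $$\mathbb{E}\big[\#\{\text{requests among } r_1,\dots,r_T \text{ rejected by the algorithm}\}\big]\;\le\; K\,\log m\,\log(c+1)\; C_{OPT}(T).$$ That is, the algorithm is $O(\log m\,\log c)$-competitive (with $\log c$ read as $\log (c+1)$, so that $c=1$ is covered). -/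

import Mathlib

open MeasureTheory ProbabilityTheory
open scoped NNReal

namespace AdmissionControl

/-- A capacitated directed network with vertex set `V` and edge set `E` (parallel edges are
allowed); every capacity is a positive integer. -/
structure Network (V E : Type*) where
  src : E → V
  tgt : E → V
  cap : E → ℕ
  cap_pos : ∀ e, 0 < cap e

namespace Network

variable {V E : Type*}

/-- A simple directed path, given by its consecutive edges: no vertex is visited twice. (The empty
list stands for a one-vertex path, which uses no edge.) -/
structure SimplePath (N : Network V E) where
  edges : List E
  isChain : edges.IsChain (fun e e' => N.tgt e = N.src e')
  nodup : ∀ e ∈ edges.head?, (N.src e :: edges.map N.tgt).Nodup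

/-- The maximum capacity `c = max_e c_e`. -/
def maxCap [Fintype E] (N : Network V E) : ℕ := Finset.univ.sup N.cap

open scoped Classical in
/-- The requests, among those with index in `A`, whose paths contain the edge `e`. -/
noncomputable def through (N : Network V E) (r : ℕ → N.SimplePath) (A : Finset ℕ) (e : E) :
    Finset ℕ :=
  A.filter (fun i => e ∈ (r i).edges)

/-- The requests with index in `A` can all be accepted simultaneously. -/
def Feasible (N : Network V E) (r : ℕ → N.SimplePath) (A : Finset ℕ) : Prop :=
  ∀ e, (N.through r A e).card ≤ N.cap e

/-- `C_OPT` for the first `T` requests `r 0, …, r (T - 1)`, all of cost `1`: the least number of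
requests rejected by a feasible solution. The set is nonempty, since all may be rejected. -/
noncomputable def optCost (N : Network V E) (r : ℕ → N.SimplePath) (T : ℕ) : ℕ :=
  sInf {k | ∃ A ⊆ Finset.range T, N.Feasible r A ∧ k = (Finset.range T \ A).card}

/-! ### The fractional algorithm, all costs being `1`

A weight function `f` assigns to every request index its weight; `t` is the number of requests
that have arrived, that is, the requests `r 0, …, r (t - 1)` are present. -/

open scoped Classical in
/-- `ALIVE_e`: the arrived requests through `e` of weight less than `1`. -/
noncomputable def alive (N : Network V E) (r : ℕ → N.SimplePath) (t : ℕ) (e : E)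
    (f : ℕ → ℝ≥0) : Finset ℕ :=
  (N.through r (Finset.range t) e).filter (fun i => f i < 1)

/-- The excess `n_e = |ALIVE_e| - c_e`, with negative values replaced by `0`. It is only compared
with a nonnegative sum of weights and used when it exceeds that sum, so the replacement changes
nothing. -/
noncomputable def excess (N : Network V E) (r : ℕ → N.SimplePath) (t : ℕ) (e : E)
    (f : ℕ → ℝ≥0) : ℕ :=
  (N.alive r t e f).card - N.cap e

/-- The requirement `∑_{i ∈ ALIVE_e} f_i ≥ n_e`, at which the loop for `e` stops. -/
def Satisfied (N : Network V E) (r : ℕ → N.SimplePath) (t : ℕ) (e : E) (f : ℕ → ℝ≥0) : Prop :=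
  (N.excess r t e f : ℝ≥0) ≤ ∑ i ∈ N.alive r t e f, f i

open scoped Classical in
/-- One weight augmentation for the edge `e`: every alive request through `e` of weight `0` gets
weight `1 / c`, and then all weights of alive requests through `e` are multiplied by
`1 + 1 / n_e`. -/
noncomputable def augment [Fintype E] (N : Network V E) (r : ℕ → N.SimplePath) (t : ℕ) (e : E)
    (f : ℕ → ℝ≥0) : ℕ → ℝ≥0 := fun i =>
  if i ∈ N.alive r t e f then
    (if f i = 0 then 1 / (N.maxCap : ℝ≥0) else f i) * (1 + 1 / (N.excess r t e f : ℝ≥0))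
  else f i

/-- The loop of weight augmentations for one edge terminates. -/
theorem exists_satisfied [Fintype E] (N : Network V E) (r : ℕ → N.SimplePath) (t : ℕ) (e : E)
    (f : ℕ → ℝ≥0) : ∃ k, N.Satisfied r t e ((N.augment r t e)^[k] f) := by
  classical
  by_contra hcon
  push Not at hcon
  set M : ℕ := (N.through r (Finset.range t) e).card with hM
  set F : ℕ → ℕ → ℝ≥0 := fun k => (N.augment r t e)^[k] f with hF
  have hcpos : 0 < N.maxCap :=
    lt_of_lt_of_le (N.cap_pos e) (Finset.le_sup (f := N.cap) (Finset.mem_univ e))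
  have hpos : ∀ k, 0 < N.excess r t e (F k) := by
    intro k
    rcases Nat.eq_zero_or_pos (N.excess r t e (F k)) with h | h
    · exact absurd (by simp [Satisfied, hF] at h ⊢; simp [h]) (hcon k)
    · exact h
  have hle : ∀ k, N.excess r t e (F k) ≤ M := fun k =>
    (Nat.sub_le _ _).trans (Finset.card_le_card (Finset.filter_subset _ _))
  have hMpos : 0 < M := (hpos 0).trans_le (hle 0)
  have hfac : ∀ k, (1 : ℝ≥0) + 1 / (M : ℝ≥0) ≤ 1 + 1 / (N.excess r t e (F k) : ℝ≥0) := by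
    intro k
    have h1 : (0 : ℝ≥0) < (N.excess r t e (F k) : ℝ≥0) := by exact_mod_cast hpos k
    have h2 : (N.excess r t e (F k) : ℝ≥0) ≤ M := by exact_mod_cast hle k
    gcongr
  have hsucc : ∀ k, F (k + 1) = N.augment r t e (F k) := fun k =>
    Function.iterate_succ_apply' _ _ _
  have halive : ∀ k i, i ∈ N.alive r t e (F (k + 1)) → i ∈ N.alive r t e (F k) := by
    intro k i hi
    by_contra hn
    have h1 : F (k + 1) i = F k i := by
      rw [hsucc]; simp only [augment, if_neg hn]
    simp only [alive, Finset.mem_filter] at hi hn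
    exact hn ⟨hi.1, h1 ▸ hi.2⟩
  have hgrow : ∀ k i, i ∈ N.alive r t e (F (k + 1)) →
      0 < F (k + 1) i ∧ (1 / (N.maxCap : ℝ≥0) ⊓ (if f i = 0 then 1 else f i)) *
        (1 + 1 / (M : ℝ≥0)) ^ (k + 1) ≤ F (k + 1) i := by
    intro k
    induction k with
    | zero =>
      intro i hi
      have h0 := halive 0 i hi
      have hF0 : F 0 i = f i := rfl
      have hval : F (0 + 1) i = (if f i = 0 then 1 / (N.maxCap : ℝ≥0) else f i) *
          (1 + 1 / (N.excess r t e (F 0) : ℝ≥0)) := by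
        rw [hsucc]; simp only [augment, if_pos h0, hF0]
      have hbase : 0 < (if f i = 0 then 1 / (N.maxCap : ℝ≥0) else f i) := by
        split_ifs with h
        · have : (0 : ℝ≥0) < N.maxCap := by exact_mod_cast hcpos
          positivity
        · exact pos_iff_ne_zero.2 h
      rw [hval]
      refine ⟨mul_pos hbase (by positivity), ?_⟩
      rw [zero_add, pow_one]
      refine mul_le_mul ?_ (hfac 0) bot_le bot_le
      split_ifs with h
      · exact inf_le_left
      · exact inf_le_right
    | succ k ih =>
      intro i hi
      have h0 := halive (k + 1) i hi
      obtain ⟨hp, hb⟩ := ih i h0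
      have hval : F (k + 1 + 1) i = F (k + 1) i *
          (1 + 1 / (N.excess r t e (F (k + 1)) : ℝ≥0)) := by
        rw [hsucc]; simp only [augment, if_pos h0, if_neg hp.ne']
      rw [hval]
      refine ⟨mul_pos hp (by positivity), ?_⟩
      rw [pow_succ, ← mul_assoc]
      exact mul_le_mul hb (hfac (k + 1)) bot_le bot_le
  have hanti : ∀ i, ∃ k₀, ∀ k ≥ k₀, i ∉ N.alive r t e (F k) := by
    intro i
    have hb : 0 < (1 / (N.maxCap : ℝ≥0) ⊓ (if f i = 0 then 1 else f i)) := by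
      refine lt_inf_iff.2 ⟨?_, ?_⟩
      · have : (0 : ℝ≥0) < N.maxCap := by exact_mod_cast hcpos
        positivity
      · split_ifs with h
        · exact one_pos
        · exact pos_iff_ne_zero.2 h
    set b := (1 / (N.maxCap : ℝ≥0) ⊓ (if f i = 0 then 1 else f i)) with hbdef
    have hone : (1 : ℝ≥0) < 1 + 1 / (M : ℝ≥0) := by
      have : (0 : ℝ≥0) < M := by exact_mod_cast hMpos
      exact lt_add_of_pos_right _ (by positivity)
    obtain ⟨n, hn⟩ := pow_unbounded_of_one_lt (1 / b) hone
    have hnot : i ∉ N.alive r t e (F (n + 1)) := by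
      intro hi
      have h1 := (hgrow n i hi).2
      have h2 : F (n + 1) i < 1 := (Finset.mem_filter.1 hi).2
      have h3 : 1 / b ≤ (1 + 1 / (M : ℝ≥0)) ^ (n + 1) :=
        hn.le.trans (pow_le_pow_right₀ hone.le (Nat.le_succ n))
      have h4 : 1 ≤ b * (1 + 1 / (M : ℝ≥0)) ^ (n + 1) := by
        calc (1 : ℝ≥0) = b * (1 / b) := by field_simp
          _ ≤ _ := mul_le_mul_right h3 _
      exact absurd (h4.trans h1) (not_le.2 h2)
    refine ⟨n + 1, fun k hk => ?_⟩
    induction k, hk using Nat.le_induction with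
    | base => exact hnot
    | succ k _ ih => exact fun h => ih (halive k i h)
  choose k₀ hk₀ using hanti
  set K := (Finset.range t).sup k₀ with hK
  have hempty : N.alive r t e (F K) = ∅ := by
    refine Finset.eq_empty_of_forall_notMem fun i hi => ?_
    have hit : i ∈ Finset.range t := by
      simp only [alive, through, Finset.mem_filter] at hi
      exact hi.1.1
    exact hk₀ i K (Finset.le_sup hit) hi
  have := hpos K
  simp [excess, hempty] at this

open scoped Classical in
/-- The loop for one edge: augment as long as the requirement for `e` is violated. -/
noncomputable def saturate [Fintype E] (N : Network V E) (r : ℕ → N.SimplePath) (t : ℕ)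
    (f : ℕ → ℝ≥0) (e : E) : ℕ → ℝ≥0 :=
  (N.augment r t e)^[Nat.find (N.exists_satisfied r t e f)] f

/-- The weights after `t` requests have been processed. When `r t` arrives, the loop is executed
for the edges of its path one after the other, in the order in which `ord t` lists them. -/
noncomputable def weights [Fintype E] (N : Network V E) (r : ℕ → N.SimplePath)
    (ord : ℕ → List E) : ℕ → ℕ → ℝ≥0
  | 0 => 0
  | t + 1 => (ord t).foldl (N.saturate r (t + 1)) (N.weights r ord t)

/-! ### The randomized algorithm for unit costs -/

open scoped Classical in
/-- The set of requests that are accepted after `t` requests have been processed, when the random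
numbers in `[0, 1]` used by the algorithm are `u`. When `r t` arrives, the weights are updated;
then, out of the previously accepted requests and `r t`, those of weight at least `1 / (4 log m)`
are rejected, and every request `i` whose weight increased by `δ` in this round is rejected if
`u (i, t) < 4 δ log m`; finally, if `r t` has survived but some edge of its path would be
over capacity, `r t` is rejected. Requests outside this set are never accepted again. -/
noncomputable def accepted [Fintype E] (N : Network V E) (r : ℕ → N.SimplePath)
    (ord : ℕ → List E) (u : ℕ × ℕ → ℝ) : ℕ → Finset ℕ
  | 0 => ∅
  | t + 1 =>
    let w := N.weights r ord t
    let w' := N.weights r ord (t + 1)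
    let S := (insert t (N.accepted r ord u t)).filter (fun i =>
      ¬ (1 / (4 * Real.log (Fintype.card E)) ≤ (w' i : ℝ)) ∧
      ¬ (u (i, t) < 4 * ((w' i : ℝ) - (w i : ℝ)) * Real.log (Fintype.card E)))
    if ∃ e ∈ (r t).edges, N.cap e < (N.through r S e).card then S.erase t else S

/-- The requests among the first `T` that are rejected (on arrival or later). -/
noncomputable def rejected [Fintype E] (N : Network V E) (r : ℕ → N.SimplePath)
    (ord : ℕ → List E) (u : ℕ × ℕ → ℝ) (T : ℕ) : Finset ℕ :=
  Finset.range T \ N.accepted r ord u T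

end Network

end AdmissionControl

namespace AdmissionControl.Network

variable {V E : Type*}

/-! The weights are a fractional solution, and the algorithm rounds it online.

Fractional part: let `R` be the set of requests rejected by an optimal solution. An augmentation for
a violated edge adds at most `5` to the total weight (`sum_augment_le`). The optimum keeps at most
`c_e` requests on the edge, so at least `n_e` alive ones lie in `R`, and each of their factors in
the potential `∏_{i ∈ R} c f_i` grows by `1 + 1 / n_e`. The logarithm of the potential therefore
grows by at least `log 2` (`log_two_le_logPotential_augment`). Weights never exceed `2`, so this
logarithm is at most `|R| log (2c)`, and the total weight is `O(log c)` times the optimum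
(`sum_weights_le`).

Rounding: a request is rejected because of its weight or by a random choice with probability at most
`8 f_i log m`. It remains to bound the rejections forced by capacities. If such a rejection occurs
on `e`, then more than `c_e` light requests through `e` survived their independent random choices.
By a Chernoff bound and the edge requirement this has probability at most `1 / m`
(`measureReal_cap_lt_card_survives_le`). On each edge it can happen only at arrivals beyond the
capacity, of which there are at most `C_OPT`. Summing over the `m` edges gives at most `C_OPT` such
rejections in expectation (`sum_measureReal_overflow_le`). -/

theorem mem_through {N : Network V E} {r : ℕ → N.SimplePath} {A : Finset ℕ} {e : E} {i : ℕ} :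
    i ∈ N.through r A e ↔ i ∈ A ∧ e ∈ (r i).edges := by
  simp [through]

theorem mem_alive {N : Network V E} {r : ℕ → N.SimplePath} {t : ℕ} {e : E} {f : ℕ → ℝ≥0} {i : ℕ} :
    i ∈ N.alive r t e f ↔ (i < t ∧ e ∈ (r i).edges) ∧ f i < 1 := by
  simp [alive, through]

theorem through_mono (N : Network V E) (r : ℕ → N.SimplePath) {A B : Finset ℕ} (h : A ⊆ B)
    (e : E) : N.through r A e ⊆ N.through r B e := fun _ hi =>
  mem_through.2 ⟨h (mem_through.1 hi).1, (mem_through.1 hi).2⟩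

theorem Feasible.mono {N : Network V E} {r : ℕ → N.SimplePath} {A B : Finset ℕ}
    (hB : N.Feasible r B) (h : A ⊆ B) : N.Feasible r A := fun e =>
  (Finset.card_le_card (N.through_mono r h e)).trans (hB e)

theorem cap_le_maxCap [Fintype E] (N : Network V E) (e : E) : N.cap e ≤ N.maxCap :=
  Finset.le_sup (f := N.cap) (Finset.mem_univ e)

/-! ### The optimum and the load of a single edge -/

theorem exists_optimal (N : Network V E) (r : ℕ → N.SimplePath) (T : ℕ) :
    ∃ A ⊆ Finset.range T, N.Feasible r A ∧ N.optCost r T = (Finset.range T \ A).card :=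
  Nat.sInf_mem (s := {k | ∃ A ⊆ Finset.range T, N.Feasible r A ∧ k = (Finset.range T \ A).card})
    ⟨_, ∅, Finset.empty_subset _, fun e => by simp [through], rfl⟩

/-- On every edge, an optimal solution rejects all requests beyond the capacity. -/
theorem card_through_sub_cap_le_optCost (N : Network V E) (r : ℕ → N.SimplePath) (T : ℕ) (e : E) :
    (N.through r (Finset.range T) e).card - N.cap e ≤ N.optCost r T := by
  obtain ⟨A, hA, hf, hopt⟩ := N.exists_optimal r T
  rw [hopt, tsub_le_iff_left]
  calc (N.through r (Finset.range T) e).card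
      ≤ (N.through r A e ∪ (Finset.range T \ A)).card := by
        refine Finset.card_le_card fun i hi => ?_
        have := mem_through.1 hi
        by_cases h : i ∈ A <;> simp_all [mem_through]
    _ ≤ _ := (Finset.card_union_le _ _).trans (Nat.add_le_add_right (hf e) _)

open scoped Classical in
/-- Among the first `T` requests, those at whose arrival the edge `e` is requested beyond its
capacity. -/
theorem card_filter_cap_lt (N : Network V E) (r : ℕ → N.SimplePath) (T : ℕ) (e : E) :
    ((Finset.range T).filter fun t => e ∈ (r t).edges ∧
      N.cap e < (N.through r (Finset.range (t + 1)) e).card).card =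
      (N.through r (Finset.range T) e).card - N.cap e := by
  induction T with
  | zero => rw [Finset.range_zero, Finset.filter_empty]; simp [through]
  | succ T ih =>
    have hthr : (N.through r (Finset.range (T + 1)) e).card =
        (N.through r (Finset.range T) e).card + if e ∈ (r T).edges then 1 else 0 := by
      unfold through
      rw [Finset.range_add_one, Finset.filter_insert]
      split_ifs
      · rw [Finset.card_insert_of_notMem (by simp)]
      · rfl
    rw [Finset.range_add_one, Finset.filter_insert, ← Finset.range_add_one]
    split_ifs with h
    · rw [Finset.card_insert_of_notMem (by simp), ih]
      rw [if_pos h.1] at hthr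
      have := h.2
      omega
    · rw [ih]
      by_cases he : e ∈ (r T).edges
      · rw [if_pos he] at hthr
        have : ¬ _ := fun h' => h ⟨he, h'⟩
        omega
      · rw [if_neg he] at hthr
        omega

/-! ### The requirement of an edge -/

/-- The requirement of `e` bounds the total truncated deficit of the requests through `e`. In this
form it is visibly monotone in the weights. -/
theorem satisfied_iff (N : Network V E) (r : ℕ → N.SimplePath) (t : ℕ) (e : E) (f : ℕ → ℝ≥0) :
    N.Satisfied r t e f ↔
      ∑ i ∈ N.through r (Finset.range t) e, (1 - f i) ≤ (N.cap e : ℝ≥0) := by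
  -- Requests of weight at least `1` have truncated deficit `0`, so only the alive ones count.
  have h1 : ∑ i ∈ N.through r (Finset.range t) e, (1 - f i) =
      ∑ i ∈ N.alive r t e f, (1 - f i) := by
    unfold alive
    rw [Finset.sum_filter]
    refine Finset.sum_congr rfl fun i _ => ?_
    split_ifs with h
    · rfl
    · exact tsub_eq_zero_of_le (not_lt.1 h)
  have h2 : ∑ i ∈ N.alive r t e f, (1 - f i) + ∑ i ∈ N.alive r t e f, f i =
      ((N.alive r t e f).card : ℝ≥0) := by
    rw [← Finset.sum_add_distrib, Finset.sum_congr rfl fun i hi =>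
      tsub_add_cancel_of_le (mem_alive.1 hi).2.le]
    simp
  rw [h1, Satisfied, excess, Nat.cast_tsub, tsub_le_iff_left, ← h2, add_comm,
    add_comm (N.cap e : ℝ≥0), add_le_add_iff_left]

theorem Satisfied.mono {N : Network V E} {r : ℕ → N.SimplePath} {t : ℕ} {e : E} {f g : ℕ → ℝ≥0}
    (hf : N.Satisfied r t e f) (hfg : f ≤ g) : N.Satisfied r t e g := by
  rw [satisfied_iff] at hf ⊢
  exact (Finset.sum_le_sum fun i _ => tsub_le_tsub_left (hfg i) 1).trans hf

theorem excess_pos {N : Network V E} {r : ℕ → N.SimplePath} {t : ℕ} {e : E} {f : ℕ → ℝ≥0}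
    (h : ¬ N.Satisfied r t e f) : 0 < N.excess r t e f := by
  rcases Nat.eq_zero_or_pos (N.excess r t e f) with h0 | h0
  · exact absurd (by simp [Satisfied, h0]) h
  · exact h0

/-! ### Requests of weight zero -/

section Untouched

open scoped Classical in
/-- The requests of weight `0` among the first `t`, on the edge `e`. -/
noncomputable def untouched (N : Network V E) (r : ℕ → N.SimplePath) (t : ℕ) (e : E) (f : ℕ → ℝ≥0) : Finset ℕ :=
  (N.through r (Finset.range t) e).filter (fun i => f i = 0)

variable {N : Network V E} {r : ℕ → N.SimplePath}

theorem untouched_anti {t : ℕ} {e : E} {f g : ℕ → ℝ≥0} (h : f ≤ g) :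
    N.untouched r t e g ⊆ N.untouched r t e f := by
  intro i hi
  simp only [untouched, Finset.mem_filter] at hi ⊢
  exact ⟨hi.1, le_antisymm (hi.2 ▸ h i) zero_le⟩

/-- Each request of weight `0` contributes a full unit to the deficit sum, which is at most `c_e`.
-/
theorem card_untouched_le {t : ℕ} {e : E} {f : ℕ → ℝ≥0} (h : N.Satisfied r t e f) :
    (N.untouched r t e f).card ≤ N.cap e := by
  rw [satisfied_iff] at h
  have : ((N.untouched r t e f).card : ℝ≥0) ≤ N.cap e := by
    refine le_trans ?_ h
    rw [Finset.card_eq_sum_ones, Nat.cast_sum, untouched, Finset.sum_filter]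
    refine Finset.sum_le_sum fun i _ => ?_
    split_ifs with h0 <;> simp [h0]
  exact_mod_cast this

theorem card_untouched_succ_le {t : ℕ} {e : E} {f : ℕ → ℝ≥0} :
    (N.untouched r (t + 1) e f).card ≤ (N.untouched r t e f).card + 1 := by
  refine (Finset.card_le_card (t := insert t (N.untouched r t e f)) fun i hi => ?_).trans
    (Finset.card_insert_le _ _)
  simp only [untouched, Finset.mem_filter, mem_through, Finset.mem_range,
    Finset.mem_insert] at hi ⊢
  have := Nat.lt_succ_iff_lt_or_eq.1 hi.1.1
  tauto

end Untouched

/-! ### The augmentation loop and the requirements it establishes -/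

section Fractional

variable [Fintype E] (N : Network V E) (r : ℕ → N.SimplePath)

theorem le_augment (t : ℕ) (e : E) (f : ℕ → ℝ≥0) : f ≤ N.augment r t e f := by
  intro i
  unfold augment
  split_ifs with h h0
  · simp [h0]
  · exact le_mul_of_one_le_right zero_le (by simp)
  · exact le_rfl

theorem augment_of_le {t : ℕ} (e : E) (f : ℕ → ℝ≥0) {i : ℕ} (h : t ≤ i) :
    N.augment r t e f i = f i := by
  rw [augment, if_neg fun hi => (mem_alive.1 hi).1.1.not_ge h]

/-- A property that is preserved by augmentations for violated edges is preserved by the loop. -/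
theorem saturate_induction {t : ℕ} {P : (ℕ → ℝ≥0) → Prop} (e : E)
    (hP : ∀ f, ¬ N.Satisfied r t e f → P f → P (N.augment r t e f)) {f : ℕ → ℝ≥0} (hf : P f) :
    P (N.saturate r t f e) := by
  classical
  have key : ∀ k ≤ Nat.find (N.exists_satisfied r t e f), P ((N.augment r t e)^[k] f) := by
    intro k
    induction k with
    | zero => exact fun _ => hf
    | succ k ih =>
      intro hk
      rw [Function.iterate_succ_apply']
      exact hP _ (Nat.find_min (N.exists_satisfied r t e f) hk) (ih (Nat.le_of_succ_le hk))
  unfold saturate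
  convert key _ le_rfl

theorem satisfied_saturate (t : ℕ) (f : ℕ → ℝ≥0) (e : E) :
    N.Satisfied r t e (N.saturate r t f e) := by
  classical
  unfold saturate
  convert Nat.find_spec (N.exists_satisfied r t e f)

theorem foldl_saturate_induction {t : ℕ} {P : (ℕ → ℝ≥0) → Prop}
    (hP : ∀ e f, ¬ N.Satisfied r t e f → P f → P (N.augment r t e f)) (l : List E)
    {f : ℕ → ℝ≥0} (hf : P f) : P (l.foldl (N.saturate r t) f) := by
  induction l generalizing f with
  | nil => exact hf
  | cons e l ih => exact ih (N.saturate_induction r e (hP e) hf)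

theorem le_foldl_saturate (t : ℕ) (l : List E) (f : ℕ → ℝ≥0) : f ≤ l.foldl (N.saturate r t) f :=
  N.foldl_saturate_induction r (P := fun g => f ≤ g)
    (fun e _ _ h => h.trans (N.le_augment r t e _)) l le_rfl

theorem satisfied_foldl_saturate (t : ℕ) {l : List E} {e : E} (he : e ∈ l) (f : ℕ → ℝ≥0) :
    N.Satisfied r t e (l.foldl (N.saturate r t) f) := by
  induction l generalizing f with
  | nil => simp at he
  | cons a l ih =>
    rcases List.mem_cons.1 he with rfl | h
    · exact (N.satisfied_saturate r t f e).mono (N.le_foldl_saturate r t l _)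
    · exact ih h _

variable (ord : ℕ → List E)

theorem weights_succ (t : ℕ) :
    N.weights r ord (t + 1) = (ord t).foldl (N.saturate r (t + 1)) (N.weights r ord t) := rfl

theorem weights_mono : Monotone (N.weights r ord) :=
  monotone_nat_of_le_succ fun t => N.le_foldl_saturate r (t + 1) (ord t) _

theorem weights_of_le {t i : ℕ} (h : t ≤ i) : N.weights r ord t i = 0 := by
  induction t with
  | zero => rfl
  | succ t ih =>
    rw [weights_succ]
    exact N.foldl_saturate_induction r (P := fun g => g i = 0)
      (fun e f _ hf => (N.augment_of_le r e f h).trans hf) _ (ih (Nat.le_of_succ_le h))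

/-- Edges on the new path are saturated, and later loops only increase weights; any other edge
receives no new request, so its old requirement persists. -/
theorem satisfied_weights (hord : ∀ t, (ord t).Perm (r t).edges) (t : ℕ) (e : E) :
    N.Satisfied r t e (N.weights r ord t) := by
  induction t with
  | zero => simp [satisfied_iff, through]
  | succ t ih =>
    by_cases he : e ∈ (r t).edges
    · exact N.satisfied_foldl_saturate r (t + 1) ((hord t).mem_iff.2 he) _
    · have h1 : N.Satisfied r (t + 1) e (N.weights r ord t) := by
        rw [satisfied_iff] at ih ⊢
        convert ih using 2
        ext i
        simp only [mem_through, Finset.mem_range]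
        constructor
        · rintro ⟨h, h'⟩
          exact ⟨lt_of_le_of_ne (Nat.le_of_lt_succ h) (by rintro rfl; exact he h'), h'⟩
        · rintro ⟨h, h'⟩
          exact ⟨h.trans (Nat.lt_succ_self t), h'⟩
      exact h1.mono (N.weights_mono r ord t.le_succ)

/-! ### The cost of the fractional solution -/

variable {N r}

/-- An alive weight is below `1`, or is initialised to `1 / c ≤ 1`, and the factor `1 + 1 / n_e` is
at most `2`. -/
theorem augment_le_two {t : ℕ} {e : E} {f : ℕ → ℝ≥0} (hs : ¬ N.Satisfied r t e f) {i : ℕ}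
    (hf : f i ≤ 2) : N.augment r t e f i ≤ 2 := by
  have hn : (1 : ℝ≥0) ≤ N.excess r t e f := by exact_mod_cast excess_pos hs
  have hc : (1 : ℝ≥0) ≤ N.maxCap := by exact_mod_cast (N.cap_pos e).trans_le (N.cap_le_maxCap e)
  have h2 : (1 : ℝ≥0) + 1 / N.excess r t e f ≤ 2 := by
    rw [← one_add_one_eq_two]
    gcongr
    exact div_le_one_of_le₀ hn zero_le
  unfold augment
  split_ifs with h h0
  · calc _ ≤ (1 : ℝ≥0) * 2 := mul_le_mul' (div_le_one_of_le₀ hc zero_le) h2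
      _ = 2 := one_mul 2
  · calc _ ≤ (1 : ℝ≥0) * 2 := mul_le_mul' (mem_alive.1 h).2.le h2
      _ = 2 := one_mul 2
  · exact hf

/-- An augmentation for a violated edge raises the total weight by at most `5`. -/
theorem sum_augment_le {t T : ℕ} {e : E} {f : ℕ → ℝ≥0} (hs : ¬ N.Satisfied r t e f) (htT : t ≤ T)
    (hz : (N.untouched r t e f).card ≤ N.cap e + 1) :
    ∑ i ∈ Finset.range T, (N.augment r t e f i : ℝ) ≤ ∑ i ∈ Finset.range T, (f i : ℝ) + 5 := by
  classical
  set A := N.alive r t e f with hA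
  set n : ℝ := (N.excess r t e f : ℝ) with hn
  set c : ℝ := (N.maxCap : ℝ) with hc
  have hn1 : 1 ≤ n := by rw [hn]; exact Nat.one_le_cast.2 (excess_pos hs)
  have hc1 : (N.cap e : ℝ) ≤ c := by rw [hc]; exact_mod_cast N.cap_le_maxCap e
  have hce : (1 : ℝ) ≤ N.cap e := by exact_mod_cast N.cap_pos e
  have hsub : A ⊆ Finset.range T := fun i hi =>
    Finset.mem_range.2 ((mem_alive.1 hi).1.1.trans_le htT)
  have hsum : ∑ i ∈ A, (f i : ℝ) ≤ n := by
    have := (not_le.1 hs).le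
    rw [hn]
    exact_mod_cast this
  have hval : ∀ i ∈ A, (N.augment r t e f i : ℝ) =
      (f i + if f i = 0 then 1 / c else 0) * (1 + 1 / n) := by
    intro i hi
    rw [augment, if_pos hi]
    split_ifs with h0
    · simp [h0, hc, hn]
    · simp [hn]
  -- At most `c_e + 1 ≤ 2c` weights are initialised, each to `1 / c`.
  have hzero : ∑ i ∈ A, (if f i = 0 then 1 / c else 0) ≤ 2 := by
    rw [← Finset.sum_filter, Finset.sum_const, nsmul_eq_mul, mul_one_div]
    have h1 : (A.filter fun i => f i = 0).card ≤ N.cap e + 1 := by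
      refine (Finset.card_le_card fun i hi => ?_).trans hz
      simp only [hA, alive, untouched, Finset.mem_filter] at hi ⊢
      exact ⟨hi.1.1, hi.2⟩
    have h2 : ((A.filter fun i => f i = 0).card : ℝ) ≤ N.cap e + 1 := by exact_mod_cast h1
    rw [div_le_iff₀ (by linarith)]
    linarith
  have hAsum : ∑ i ∈ A, (N.augment r t e f i : ℝ) ≤ ∑ i ∈ A, (f i : ℝ) + 5 := by
    rw [Finset.sum_congr rfl hval, ← Finset.sum_mul, Finset.sum_add_distrib]
    set x := ∑ i ∈ A, (f i : ℝ)
    set y := ∑ i ∈ A, (if f i = 0 then 1 / c else 0)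
    -- The multiplication adds `(x + y) / n ≤ (n + 2) / n ≤ 3`; with `y ≤ 2` from the initialisation
    -- this gives `5`.
    have h3 : (x + y) * (1 / n) ≤ 3 := by
      rw [mul_one_div, div_le_iff₀ (by linarith)]
      linarith
    rw [mul_add, mul_one]
    linarith
  rw [← Finset.sum_sdiff hsub, ← Finset.sum_sdiff hsub (f := fun i => (f i : ℝ))]
  have : ∑ i ∈ Finset.range T \ A, (N.augment r t e f i : ℝ) =
      ∑ i ∈ Finset.range T \ A, (f i : ℝ) :=
    Finset.sum_congr rfl fun i hi => by rw [augment, if_neg (Finset.mem_sdiff.1 hi).2]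
  linarith

/-- The logarithm of the potential, `R` being the set of requests rejected by the comparison
solution. Requests of weight `0` contribute `log 0 = 0`. -/
noncomputable def logPotential (N : Network V E) (R : Finset ℕ) (f : ℕ → ℝ≥0) : ℝ :=
  ∑ i ∈ R, Real.log (N.maxCap * f i)

/-- An augmentation for a violated edge at least doubles the potential. -/
theorem log_two_le_logPotential_augment {t T : ℕ} {e : E} {f : ℕ → ℝ≥0}
    (hs : ¬ N.Satisfied r t e f) (htT : t ≤ T) {A : Finset ℕ} (hA : N.Feasible r A) :
    N.logPotential (Finset.range T \ A) f + Real.log 2 ≤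
      N.logPotential (Finset.range T \ A) (N.augment r t e f) := by
  classical
  set R := Finset.range T \ A with hR
  set n := N.excess r t e f with hn
  have hn0 : 0 < n := excess_pos hs
  have hn1 : (0 : ℝ) < n := by exact_mod_cast hn0
  have hc0 : (0 : ℝ) < N.maxCap := by
    exact_mod_cast (N.cap_pos e).trans_le (N.cap_le_maxCap e)
  have hl0 : 0 ≤ Real.log (1 + 1 / n) := Real.log_nonneg (by simp)
  -- The feasible set `A` contains at most `c_e` of the alive requests, so at least `n_e` of them
  -- belong to `R`.
  have hcard : n ≤ (R.filter fun i => i ∈ N.alive r t e f).card := by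
    have h1 : (N.alive r t e f).card ≤
        (N.through r A e ∪ R.filter fun i => i ∈ N.alive r t e f).card := by
      refine Finset.card_le_card fun i hi => ?_
      have := mem_alive.1 hi
      by_cases h : i ∈ A
      · exact Finset.mem_union_left _ (mem_through.2 ⟨h, this.1.2⟩)
      · exact Finset.mem_union_right _ (Finset.mem_filter.2
          ⟨Finset.mem_sdiff.2 ⟨Finset.mem_range.2 (this.1.1.trans_le htT), h⟩, hi⟩)
    have h2 := Finset.card_union_le (N.through r A e) (R.filter fun i => i ∈ N.alive r t e f)
    have h3 := hA e
    rw [hn, excess]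
    omega
  -- The convention `log 0 = 0` makes weight `0` behave like weight `1 / c`, so initialising a
  -- weight leaves its term unchanged and only the factor counts.
  have hterm : ∀ i ∈ R, Real.log (N.maxCap * N.augment r t e f i) =
      Real.log (N.maxCap * f i) + if i ∈ N.alive r t e f then Real.log (1 + 1 / n) else 0 := by
    intro i _
    unfold augment
    split_ifs with h h0
    · simp only [h0, NNReal.coe_mul, NNReal.coe_div, NNReal.coe_one, NNReal.coe_natCast,
        NNReal.coe_add, NNReal.coe_zero, mul_zero, Real.log_zero, zero_add, ← hn]
      congr 1
      field_simp
    · have hf0 : (0 : ℝ) < f i := by exact_mod_cast pos_iff_ne_zero.2 h0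
      rw [NNReal.coe_mul, ← mul_assoc, Real.log_mul (by positivity) (by positivity)]
      simp [hn]
    · simp
  -- Bernoulli: `(1 + 1 / n) ^ n ≥ 2`.
  have hpow : Real.log 2 ≤ n * Real.log (1 + 1 / n) := by
    rw [← Real.log_pow]
    refine Real.log_le_log two_pos ?_
    have := one_add_mul_le_pow (a := (1 : ℝ) / n) (by linarith [one_div_pos.2 hn1]) n
    rwa [mul_one_div_cancel hn1.ne', one_add_one_eq_two] at this
  unfold logPotential
  rw [Finset.sum_congr rfl hterm, Finset.sum_add_distrib, ← Finset.sum_filter, Finset.sum_const,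
    nsmul_eq_mul]
  have : (n : ℝ) * Real.log (1 + 1 / n) ≤
      ((R.filter fun i => i ∈ N.alive r t e f).card : ℝ) * Real.log (1 + 1 / n) := by
    gcongr
  linarith

/-- The weights are bounded, few requests on an edge have weight `0`, and the total weight is
controlled by the potential. -/
structure WeightInvariant (N : Network V E) (r : ℕ → N.SimplePath) (T : ℕ) (R : Finset ℕ) (t : ℕ)
    (f : ℕ → ℝ≥0) : Prop where
  le_two : ∀ i, f i ≤ 2
  card_untouched_le : ∀ e, (N.untouched r t e f).card ≤ N.cap e + 1
  sum_le : Real.log 2 * ∑ i ∈ Finset.range T, (f i : ℝ) ≤ 5 * N.logPotential R f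

theorem WeightInvariant.augment {T t : ℕ} {A : Finset ℕ} {f : ℕ → ℝ≥0} {e : E}
    (hI : N.WeightInvariant r T (Finset.range T \ A) t f) (hA : N.Feasible r A) (htT : t ≤ T)
    (hs : ¬ N.Satisfied r t e f) :
    N.WeightInvariant r T (Finset.range T \ A) t (N.augment r t e f) where
  le_two i := augment_le_two hs (hI.le_two i)
  card_untouched_le e' :=
    (Finset.card_le_card (untouched_anti (N.le_augment r t e f))).trans (hI.card_untouched_le e')
  sum_le := by
    have h1 := log_two_le_logPotential_augment hs htT hA
    have h2 := mul_le_mul_of_nonneg_left (sum_augment_le hs htT (hI.card_untouched_le e))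
      (Real.log_nonneg one_le_two)
    have h3 := hI.sum_le
    linarith

theorem weightInvariant_weights (hord : ∀ t, (ord t).Perm (r t).edges) {T t : ℕ} {A : Finset ℕ}
    (hA : N.Feasible r A) (htT : t ≤ T) :
    N.WeightInvariant r T (Finset.range T \ A) t (N.weights r ord t) := by
  induction t with
  | zero => exact ⟨by simp [weights], by simp [untouched, through], by simp [weights, logPotential]⟩
  | succ t ih =>
    have hI := ih (Nat.le_of_succ_le htT)
    rw [weights_succ]
    refine N.foldl_saturate_induction r (fun e f hs hf => hf.augment hA htT hs) _
      ⟨hI.le_two, fun e => ?_, hI.sum_le⟩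
    -- Only the arriving request can join the at most `c_e` requests of weight `0` left by the
    -- previous round.
    exact card_untouched_succ_le.trans
      (Nat.add_le_add_right (card_untouched_le (N.satisfied_weights r ord hord t e)) 1)

/-- The fractional algorithm is `O(log c)`-competitive. -/
theorem sum_weights_le [Nonempty E] (hord : ∀ t, (ord t).Perm (r t).edges) (T : ℕ) :
    Real.log 2 * ∑ i ∈ Finset.range T, (N.weights r ord T i : ℝ) ≤
      10 * Real.log (N.maxCap + 1) * N.optCost r T := by
  obtain ⟨A, -, hA, hopt⟩ := N.exists_optimal r T
  have hI := weightInvariant_weights ord hord hA (le_refl T)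
  have hc : (1 : ℝ) ≤ N.maxCap := by
    obtain ⟨e⟩ := ‹Nonempty E›
    exact_mod_cast (N.cap_pos e).trans_le (N.cap_le_maxCap e)
  -- `2c ≤ (c + 1) ^ 2`; the factor `2` inside is the bound on the weights.
  have hlog : Real.log (2 * N.maxCap) ≤ 2 * Real.log (N.maxCap + 1) := by
    rw [← Nat.cast_ofNat (n := 2), ← Real.log_pow]
    refine Real.log_le_log (by positivity) ?_
    push_cast
    nlinarith
  have hterm : ∀ i ∈ Finset.range T \ A, Real.log (N.maxCap * N.weights r ord T i) ≤
      2 * Real.log (N.maxCap + 1) := by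
    intro i _
    rcases eq_or_ne (N.weights r ord T i) 0 with h0 | h0
    · simp only [h0, NNReal.coe_zero, mul_zero, Real.log_zero]
      exact mul_nonneg two_pos.le (Real.log_nonneg (by linarith))
    · refine le_trans (Real.log_le_log ?_ ?_) hlog
      · have : (0 : ℝ) < N.weights r ord T i := by exact_mod_cast pos_iff_ne_zero.2 h0
        positivity
      · have : (N.weights r ord T i : ℝ) ≤ 2 := by exact_mod_cast hI.le_two i
        nlinarith
  have h1 := hI.sum_le
  have h2 := Finset.sum_le_card_nsmul _ _ _ hterm
  rw [nsmul_eq_mul, ← hopt] at h2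
  change N.logPotential (Finset.range T \ A) (N.weights r ord T) ≤ _ at h2
  linarith

end Fractional

/-! ### Deterministic properties of the randomized algorithm -/

section Randomized

variable {V E : Type*} [Fintype E] (N : Network V E) (r : ℕ → N.SimplePath) (ord : ℕ → List E)

/-- The number `4 δ log m`, where `δ` is the increase of the weight of request `i` in round `t`. -/
noncomputable def rejectProb (i t : ℕ) : ℝ :=
  4 * ((N.weights r ord (t + 1) i : ℝ) - (N.weights r ord t i : ℝ)) * Real.log (Fintype.card E)

/-- After `t` rounds, the weight of request `i` has not reached `1 / (4 log m)`. -/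
def IsLight (t i : ℕ) : Prop :=
  (N.weights r ord t i : ℝ) < 1 / (4 * Real.log (Fintype.card E))

open scoped Classical in
/-- The requests that are still accepted in round `t` before the capacities are checked. -/
noncomputable def candidates (u : ℕ × ℕ → ℝ) (t : ℕ) : Finset ℕ :=
  (insert t (N.accepted r ord u t)).filter (fun i =>
    N.IsLight r ord (t + 1) i ∧ N.rejectProb r ord i t ≤ u (i, t))

open scoped Classical in
/-- Remove request `t` from `S` if `S` exceeds a capacity on its path. -/
noncomputable def checkCapacities (t : ℕ) (S : Finset ℕ) : Finset ℕ :=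
  if ∃ e ∈ (r t).edges, N.cap e < (N.through r S e).card then S.erase t else S

/-- Accepting request `t` would exceed a capacity. -/
def Overflow (u : ℕ × ℕ → ℝ) (t : ℕ) : Prop :=
  ∃ e ∈ (r t).edges, N.cap e < (N.through r (N.candidates r ord u t) e).card

/-- Request `i` is rejected by none of the random choices made in the rounds before `t`. -/
def Survives (u : ℕ × ℕ → ℝ) (t i : ℕ) : Prop :=
  ∀ s ∈ Finset.range t, i ≤ s → N.rejectProb r ord i s ≤ u (i, s)

variable {N r ord}

theorem accepted_succ (u : ℕ × ℕ → ℝ) (t : ℕ) :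
    N.accepted r ord u (t + 1) = N.checkCapacities r t (N.candidates r ord u t) := by
  simp only [accepted, checkCapacities, candidates, IsLight, rejectProb, not_le, not_lt]
  congr!

theorem accepted_succ_subset (u : ℕ × ℕ → ℝ) (t : ℕ) :
    N.accepted r ord u (t + 1) ⊆ N.candidates r ord u t := by
  classical
  rw [accepted_succ, checkCapacities]
  split_ifs
  · exact Finset.erase_subset _ _
  · exact subset_rfl

theorem candidates_subset (u : ℕ × ℕ → ℝ) (t : ℕ) :
    N.candidates r ord u t ⊆ insert t (N.accepted r ord u t) := by
  classical
  exact Finset.filter_subset _ _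

theorem accepted_subset_range (u : ℕ × ℕ → ℝ) (t : ℕ) :
    N.accepted r ord u t ⊆ Finset.range t := by
  induction t with
  | zero => simp [accepted]
  | succ t ih =>
    refine (accepted_succ_subset u t).trans ((candidates_subset u t).trans ?_)
    rw [Finset.range_add_one]
    exact Finset.insert_subset_insert _ ih

/-- Checking the edges of the new path suffices: elsewhere the candidates are among the previously
accepted requests. Dropping `t` also leaves only such requests. -/
theorem feasible_accepted (u : ℕ × ℕ → ℝ) (t : ℕ) : N.Feasible r (N.accepted r ord u t) := by
  classical
  induction t with
  | zero => simp [accepted, Feasible, through]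
  | succ t ih =>
    rw [accepted_succ, checkCapacities]
    split_ifs with h
    · refine ih.mono fun i hi => ?_
      rw [Finset.mem_erase] at hi
      exact (Finset.mem_insert.1 (candidates_subset u t hi.2)).resolve_left hi.1
    · intro e
      by_cases he : e ∈ (r t).edges
      · exact not_lt.1 fun hlt => h ⟨e, he, hlt⟩
      · refine (Finset.card_le_card fun i hi => ?_).trans (ih e)
        obtain ⟨h1, h2⟩ := mem_through.1 hi
        refine mem_through.2 ⟨?_, h2⟩
        rcases Finset.mem_insert.1 (candidates_subset u t h1) with rfl | h3
        · exact absurd h2 he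
        · exact h3

theorem rejected_subset_succ (u : ℕ × ℕ → ℝ) (t : ℕ) :
    N.rejected r ord u t ⊆ N.rejected r ord u (t + 1) := by
  intro i hi
  rw [rejected, Finset.mem_sdiff, Finset.mem_range] at hi ⊢
  refine ⟨hi.1.trans t.lt_succ_self, fun h => ?_⟩
  rcases Finset.mem_insert.1 (candidates_subset u t (accepted_succ_subset u t h)) with h1 | h1
  · exact hi.1.ne h1
  · exact hi.2 h1

theorem survives_succ {u : ℕ × ℕ → ℝ} {t i : ℕ} (h : i = t ∨ N.Survives r ord u t i)
    (h' : N.rejectProb r ord i t ≤ u (i, t)) : N.Survives r ord u (t + 1) i := by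
  intro s hs his
  rcases Nat.lt_succ_iff_lt_or_eq.1 (Finset.mem_range.1 hs) with h1 | rfl
  · rcases h with rfl | h
    · omega
    · exact h s (Finset.mem_range.2 h1) his
  · exact h'

theorem survives_of_mem_accepted {u : ℕ × ℕ → ℝ} {t i : ℕ} (h : i ∈ N.accepted r ord u t) :
    N.Survives r ord u t i := by
  classical
  induction t with
  | zero => simp [accepted] at h
  | succ t ih =>
    have h1 := Finset.mem_filter.1 (accepted_succ_subset u t h)
    exact survives_succ ((Finset.mem_insert.1 h1.1).imp_right ih) h1.2.2

open scoped Classical in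
-- Acceptance depends on earlier capacity checks, which correlate the requests. This passes to a
-- larger set described by the random choices alone, where survival is independent across requests.
theorem through_candidates_subset (u : ℕ × ℕ → ℝ) (t : ℕ) (e : E) :
    N.through r (N.candidates r ord u t) e ⊆
      ((N.through r (Finset.range (t + 1)) e).filter (N.IsLight r ord (t + 1))).filter
        (N.Survives r ord u (t + 1)) := by
  intro i hi
  obtain ⟨h1, h2⟩ := mem_through.1 hi
  obtain ⟨h3, h4, h5⟩ := Finset.mem_filter.1 h1
  refine Finset.mem_filter.2 ⟨Finset.mem_filter.2 ⟨mem_through.2 ⟨?_, h2⟩, h4⟩, ?_⟩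
  · rw [Finset.range_add_one]
    exact Finset.insert_subset_insert _ (accepted_subset_range u t) h3
  · exact survives_succ ((Finset.mem_insert.1 h3).imp_right survives_of_mem_accepted) h5

/-- A rejected request has a large weight, or a random choice rejected it, or it was rejected on
arrival because of the capacities. -/
theorem of_mem_rejected {u : ℕ × ℕ → ℝ} {T i : ℕ} (h : i ∈ N.rejected r ord u T) :
    ¬ N.IsLight r ord T i ∨ ¬ N.Survives r ord u T i ∨ N.Overflow r ord u i := by
  classical
  induction T with
  | zero => simp [rejected] at h
  | succ T ih =>
    rw [rejected, Finset.mem_sdiff, Finset.mem_range] at h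
    by_cases hi : i ∈ insert T (N.accepted r ord u T)
    · by_cases hc : i ∈ N.candidates r ord u T
      · rw [accepted_succ, checkCapacities] at h
        split_ifs at h with ho
        · have : i = T := by
            by_contra hne
            exact h.2 (Finset.mem_erase.2 ⟨hne, hc⟩)
          exact Or.inr (Or.inr (this ▸ ho))
        · exact absurd hc h.2
      · rw [candidates, Finset.mem_filter, not_and, not_and_or] at hc
        refine (hc hi).imp_right fun h1 => Or.inl fun h2 => h1 (h2 T (by simp) ?_)
        exact Nat.le_of_lt_succ h.1
    · rw [Finset.mem_insert, not_or] at hi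
      have hiT : i < T := lt_of_le_of_ne (Nat.le_of_lt_succ h.1) hi.1
      rcases ih (Finset.mem_sdiff.2 ⟨Finset.mem_range.2 hiT, hi.2⟩) with h1 | h1 | h1
      · refine Or.inl fun h2 => h1 (lt_of_le_of_lt ?_ h2)
        exact_mod_cast N.weights_mono r ord T.le_succ i
      · refine Or.inr (Or.inl fun h2 => h1 fun s hs => h2 s ?_)
        exact Finset.mem_range.2 ((Finset.mem_range.1 hs).trans T.lt_succ_self)
      · exact Or.inr (Or.inr h1)

theorem log_card_nonneg : 0 ≤ Real.log (Fintype.card E) := Real.log_natCast_nonneg _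

theorem rejectProb_nonneg (i t : ℕ) : 0 ≤ N.rejectProb r ord i t := by
  have : (N.weights r ord t i : ℝ) ≤ N.weights r ord (t + 1) i := by
    exact_mod_cast N.weights_mono r ord t.le_succ i
  exact mul_nonneg (by linarith) log_card_nonneg

theorem rejectProb_eq_zero {i t : ℕ} (h : t < i) : N.rejectProb r ord i t = 0 := by
  simp [rejectProb, N.weights_of_le r ord (Nat.succ_le_of_lt h), N.weights_of_le r ord h.le]

/-- The weight increments telescope from `0`. -/
theorem sum_rejectProb (i t : ℕ) : ∑ s ∈ Finset.range t, N.rejectProb r ord i s =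
    4 * Real.log (Fintype.card E) * N.weights r ord t i := by
  have h := Finset.sum_range_sub (fun s => (N.weights r ord s i : ℝ)) t
  have h0 : (N.weights r ord 0 i : ℝ) = 0 := by simp [weights]
  rw [h0, sub_zero] at h
  rw [← h, Finset.mul_sum]
  exact Finset.sum_congr rfl fun s _ => by unfold rejectProb; ring

/-! ### Measurability -/

/-- The values of the random numbers for which the choices in the rounds before `t` do not reject
request `i`, one constraint for every pair. -/
noncomputable def surviveSet (N : Network V E) (r : ℕ → N.SimplePath) (ord : ℕ → List E)
    (p : ℕ × ℕ) : Set ℝ :=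
  if p.1 ≤ p.2 then Set.Ici (N.rejectProb r ord p.1 p.2) else Set.univ

/-- One constraint per random number, the form required for using independence. -/
theorem setOf_survives {Ω : Type*} {U : ℕ × ℕ → Ω → ℝ} (t i : ℕ) : {ω | N.Survives r ord (fun p => U p ω) t i} =
    ⋂ s ∈ Finset.range t, U (i, s) ⁻¹' N.surviveSet r ord (i, s) := by
  ext ω
  simp only [Survives, Set.mem_ofPred_eq, Set.mem_iInter, Set.mem_preimage, surviveSet]
  refine forall₂_congr fun s _ => ?_
  split_ifs with h <;> simp [h]

/-- The accepted set takes finitely many values, so a round splits according to the set `D` of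
indices passing their random choice. Once `D` is fixed, the event is another predicate of the
previous accepted set, hence the induction over all `P`. -/
theorem measurableSet_accepted {Ω : Type*} [MeasurableSpace Ω] {U : ℕ × ℕ → Ω → ℝ}
    (hU : ∀ p, Measurable (U p)) (T : ℕ) (P : Finset ℕ → Prop) :
    MeasurableSet {ω | P (N.accepted r ord (fun p => U p ω) T)} := by
  classical
  induction T generalizing P with
  | zero => exact MeasurableSet.const (P ∅)
  | succ t ih =>
    have hfin : {ω | P (N.accepted r ord (fun p => U p ω) (t + 1))} =
        ⋃ D ∈ (Finset.range (t + 1)).powerset,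
          {ω | P (N.checkCapacities r t ((insert t (N.accepted r ord (fun p => U p ω) t)).filter
            fun i => N.IsLight r ord (t + 1) i ∧ i ∈ D))} ∩
          ⋂ i ∈ Finset.range (t + 1), {ω | i ∈ D ↔ N.rejectProb r ord i t ≤ U (i, t) ω} := by
      have key : ∀ (ω : Ω) (D : Finset ℕ),
          (∀ i ∈ Finset.range (t + 1), (i ∈ D ↔ N.rejectProb r ord i t ≤ U (i, t) ω)) →
          (insert t (N.accepted r ord (fun p => U p ω) t)).filter (fun i =>
            N.IsLight r ord (t + 1) i ∧ i ∈ D) = N.candidates r ord (fun p => U p ω) t := by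
        intro ω D hD
        refine Finset.filter_congr fun i hi => and_congr_right fun _ => hD i ?_
        rw [Finset.range_add_one]
        exact Finset.insert_subset_insert _ (accepted_subset_range _ t) hi
      ext ω
      simp only [Set.mem_iUnion, Set.mem_inter_iff, Set.mem_iInter, Set.mem_ofPred_eq, exists_prop]
      constructor
      · intro h
        have hD : ∀ i ∈ Finset.range (t + 1), (i ∈ (Finset.range (t + 1)).filter
            (fun i => N.rejectProb r ord i t ≤ U (i, t) ω) ↔
              N.rejectProb r ord i t ≤ U (i, t) ω) := fun i hi => by
          rw [Finset.mem_filter, and_iff_right hi]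
        refine ⟨_, Finset.mem_powerset.2 (Finset.filter_subset _ _), ?_, hD⟩
        rw [accepted_succ] at h
        rw [key ω _ hD]
        exact h
      · rintro ⟨D, -, h, hD⟩
        rw [key ω _ hD] at h
        rw [accepted_succ]
        exact h
    rw [hfin]
    refine Finset.measurableSet_biUnion _ fun D _ => (ih fun A => P (N.checkCapacities r t
      ((insert t A).filter fun i => N.IsLight r ord (t + 1) i ∧ i ∈ D))).inter
        (Finset.measurableSet_biInter _ fun i _ => ?_)
    exact (MeasurableSet.const _).iff (measurableSet_le measurable_const (hU _))

end Randomized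

end AdmissionControl.Network

namespace AdmissionControl

/-! ### Probabilistic tools -/

section Probability

variable {Ω : Type*} [MeasurableSpace Ω] {μ : Measure Ω}

open scoped Classical in
/-- A Chernoff-type bound with base `2` for the number of occurring events. -/
theorem two_pow_mul_measureReal_card_le [IsFiniteMeasure μ] {ι : Type*} (L : Finset ι)
    (S : ι → Set Ω) (hS : ∀ i, MeasurableSet (S i)) (q : ι → ℝ)
    (hq : ∀ A ⊆ L, μ.real (⋂ i ∈ A, S i) = ∏ i ∈ A, q i) (k : ℕ) :
    2 ^ k * μ.real {ω | k ≤ (L.filter fun i => ω ∈ S i).card} ≤ ∏ i ∈ L, (1 + q i) := by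
  have hmeas : ∀ A : Finset ι, MeasurableSet (⋂ i ∈ A, S i) := fun A =>
    Finset.measurableSet_biInter _ fun i _ => hS i
  -- Counting subsets of the occurring events gives `F = 2 ^ (number of occurring events)`, while
  -- its integral expands `∏ (1 + q i)`; the claim is Markov's inequality for `F`.
  set F : Ω → ℝ := fun ω => ∑ A ∈ L.powerset, (⋂ i ∈ A, S i).indicator 1 ω with hF
  have hint : ∀ A ∈ L.powerset, Integrable ((⋂ i ∈ A, S i).indicator (1 : Ω → ℝ)) μ :=
    fun A _ => (integrable_const 1).indicator (hmeas A)
  have hFval : ∀ ω, F ω = 2 ^ (L.filter fun i => ω ∈ S i).card := by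
    intro ω
    simp only [hF, Set.indicator_apply, Pi.one_apply]
    rw [Finset.sum_boole, ← Nat.cast_ofNat (n := 2), ← Nat.cast_pow, ← Finset.card_powerset]
    congr 2
    ext A
    simp only [Finset.mem_filter, Finset.mem_powerset, Set.mem_iInter, Finset.subset_iff]
    exact ⟨fun h i hi => ⟨h.1 hi, h.2 i hi⟩, fun h => ⟨fun i hi => (h hi).1, fun i hi => (h hi).2⟩⟩
  have hle := mul_meas_ge_le_integral_of_nonneg (μ := μ) (f := F)
    (Filter.Eventually.of_forall fun ω => by simp only [hFval, Pi.zero_apply]; positivity)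
    (integrable_finsetSum _ hint) (2 ^ k)
  rw [hF, integral_finsetSum _ hint] at hle
  rw [Finset.prod_one_add, ← Finset.sum_congr rfl fun A hA => hq A (Finset.mem_powerset.1 hA)]
  rw [Finset.sum_congr rfl fun A _ => integral_indicator_one (hmeas A)] at hle
  convert hle using 4
  ext ω
  change _ ↔ 2 ^ k ≤ F ω
  rw [hFval]
  exact (pow_le_pow_iff_right₀ (one_lt_two (α := ℝ))).symm

theorem measureReal_lt_le {X : Ω → ℝ} (hX : Measurable X)
    (hlaw : μ.map X = (volume : Measure ℝ).restrict (Set.Icc 0 1)) {a : ℝ} (ha : 0 ≤ a) :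
    μ.real {ω | X ω < a} ≤ a := by
  have h : μ {ω | X ω < a} = volume (Set.Iio a ∩ Set.Icc 0 1) := by
    rw [← Measure.restrict_apply measurableSet_Iio, ← hlaw, Measure.map_apply hX measurableSet_Iio]
    rfl
  rw [measureReal_def, h]
  refine ENNReal.toReal_le_of_le_ofReal ha ?_
  calc volume (Set.Iio a ∩ Set.Icc 0 1) ≤ volume (Set.Ico 0 a) :=
        measure_mono fun x hx => ⟨hx.2.1, hx.1⟩
    _ = ENNReal.ofReal a := by rw [Real.volume_Ico, sub_zero]

theorem measureReal_le_le_exp {X : Ω → ℝ} (hX : Measurable X)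
    (hlaw : μ.map X = (volume : Measure ℝ).restrict (Set.Icc 0 1)) (a : ℝ) :
    μ.real (X ⁻¹' Set.Ici a) ≤ Real.exp (-a) := by
  rw [measureReal_def, ← Measure.map_apply hX measurableSet_Ici, hlaw,
    Measure.restrict_apply measurableSet_Ici]
  refine ENNReal.toReal_le_of_le_ofReal (Real.exp_pos _).le ?_
  calc volume (Set.Ici a ∩ Set.Icc 0 1) ≤ volume (Set.Icc a 1) :=
        measure_mono fun x hx => ⟨hx.1, hx.2.2⟩
    _ = ENNReal.ofReal (1 - a) := Real.volume_Icc
    _ ≤ _ := ENNReal.ofReal_le_ofReal (by linarith [Real.add_one_le_exp (-a)])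

/-- Writing `1 + e^{-y} = 2 e^{-y/2} cosh (y/2)` and using `cosh x ≤ e^{x²/2}` leaves the exponent
`-y/2 + y²/8`, which is at most `-3y/8` on `[0, 1]`. -/
theorem one_add_exp_neg_le {y : ℝ} (h0 : 0 ≤ y) (h1 : y ≤ 1) :
    1 + Real.exp (-y) ≤ 2 * Real.exp (-(3 / 8 * y)) := by
  have h : 1 + Real.exp (-y) = 2 * (Real.exp (-(y / 2)) * Real.cosh (y / 2)) := by
    rw [Real.cosh_eq]
    have e1 : Real.exp (-(y / 2)) * Real.exp (y / 2) = 1 := by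
      rw [← Real.exp_add, neg_add_cancel, Real.exp_zero]
    have e2 : Real.exp (-(y / 2)) * Real.exp (-(y / 2)) = Real.exp (-y) := by
      rw [← Real.exp_add]; congr 1; ring
    linear_combination -e1 - e2
  rw [h]
  refine mul_le_mul_of_nonneg_left ?_ two_pos.le
  calc Real.exp (-(y / 2)) * Real.cosh (y / 2)
      ≤ Real.exp (-(y / 2)) * Real.exp ((y / 2) ^ 2 / 2) :=
        mul_le_mul_of_nonneg_left (Real.cosh_le_exp_half_sq _) (Real.exp_pos _).le
    _ = Real.exp (-(y / 2) + (y / 2) ^ 2 / 2) := (Real.exp_add _ _).symm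
    _ ≤ _ := Real.exp_le_exp.2 (by nlinarith)

end Probability

namespace Network

/-! ### Rejection probabilities and their sum -/

section Expectation

variable {V E : Type*} [Fintype E] {N : Network V E} {r : ℕ → N.SimplePath} {ord : ℕ → List E}
  {Ω : Type*} [MeasurableSpace Ω] {μ : Measure Ω} {U : ℕ × ℕ → Ω → ℝ}

theorem log_two_le_log_card (hm : 2 ≤ Fintype.card E) :
    Real.log 2 ≤ Real.log (Fintype.card E) :=
  Real.log_le_log two_pos (by exact_mod_cast hm)

theorem four_mul_log_mul_weight_lt (hm : 2 ≤ Fintype.card E) {t i : ℕ}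
    (h : N.IsLight r ord t i) :
    4 * Real.log (Fintype.card E) * N.weights r ord t i < 1 := by
  have hl := log_two_le_log_card hm
  have := Real.log_two_gt_d9
  rw [IsLight, lt_div_iff₀ (by linarith)] at h
  linarith

theorem weight_lt_one (hm : 2 ≤ Fintype.card E) {t i : ℕ} (h : N.IsLight r ord t i) :
    N.weights r ord t i < 1 := by
  have h1 := four_mul_log_mul_weight_lt hm h
  have hl := log_two_le_log_card hm
  have := Real.log_two_gt_d9
  have h2 : (N.weights r ord t i : ℝ) < 1 := by
    nlinarith [(N.weights r ord t i).coe_nonneg]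
  exact_mod_cast h2

theorem measurableSet_surviveSet (p : ℕ × ℕ) : MeasurableSet (N.surviveSet r ord p) := by
  unfold surviveSet
  split_ifs
  · exact measurableSet_Ici
  · exact MeasurableSet.univ

theorem measurableSet_survives (hU : ∀ p, Measurable (U p)) (t i : ℕ) :
    MeasurableSet {ω | N.Survives r ord (fun p => U p ω) t i} := by
  rw [setOf_survives]
  exact Finset.measurableSet_biInter _ fun s _ => hU _ (measurableSet_surviveSet _)

/-- Different requests use disjoint families of random numbers, so the joint probability is a
product over the rectangle of pairs. -/
theorem measureReal_iInter_preimage_surviveSet (hind : iIndepFun U μ) (A : Finset ℕ) (t : ℕ) :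
    μ.real (⋂ i ∈ A, {ω | N.Survives r ord (fun p => U p ω) t i}) =
      ∏ i ∈ A, ∏ s ∈ Finset.range t, μ.real (U (i, s) ⁻¹' N.surviveSet r ord (i, s)) := by
  have h := hind.measure_inter_preimage_eq_mul (A ×ˢ Finset.range t)
    (sets := N.surviveSet r ord) fun p _ => measurableSet_surviveSet p
  rw [Finset.prod_product] at h
  simp only [measureReal_def]
  simp only [← ENNReal.toReal_prod]
  rw [← h]
  congr 2
  ext ω
  simp only [setOf_survives, Set.mem_iInter, Finset.mem_product, Prod.forall]
  exact ⟨fun H i s his => H i his.1 s his.2, fun H i hi s hs => H i s ⟨hi, hs⟩⟩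

theorem prod_measureReal_surviveSet_le [IsProbabilityMeasure μ] (hU : ∀ p, Measurable (U p))
    (hlaw : ∀ p, μ.map (U p) = (volume : Measure ℝ).restrict (Set.Icc 0 1)) (t i : ℕ) :
    ∏ s ∈ Finset.range t, μ.real (U (i, s) ⁻¹' N.surviveSet r ord (i, s)) ≤
      Real.exp (-(4 * Real.log (Fintype.card E) * N.weights r ord t i)) := by
  rw [← sum_rejectProb, ← Finset.sum_neg_distrib, Real.exp_sum]
  refine Finset.prod_le_prod (fun s _ => measureReal_nonneg) fun s _ => ?_
  unfold surviveSet
  split_ifs with h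
  · exact measureReal_le_le_exp (hU _) (hlaw _) _
  -- Before its arrival a request has rejection probability `0`, and the constraint is void.
  · simp [rejectProb_eq_zero (not_le.1 h)]

theorem measureReal_not_survives_le [IsFiniteMeasure μ] (hU : ∀ p, Measurable (U p))
    (hlaw : ∀ p, μ.map (U p) = (volume : Measure ℝ).restrict (Set.Icc 0 1)) (t i : ℕ) :
    μ.real {ω | ¬ N.Survives r ord (fun p => U p ω) t i} ≤
      4 * Real.log (Fintype.card E) * N.weights r ord t i := by
  rw [← sum_rejectProb]
  calc μ.real {ω | ¬ N.Survives r ord (fun p => U p ω) t i}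
      ≤ μ.real (⋃ s ∈ Finset.range t, {ω | U (i, s) ω < N.rejectProb r ord i s}) := by
        refine measureReal_mono (fun ω hω => ?_) (measure_ne_top _ _)
        simp only [Survives, Set.mem_ofPred_eq, not_forall, not_le] at hω
        obtain ⟨s, hs, -, h⟩ := hω
        exact Set.mem_biUnion hs h
    _ ≤ ∑ s ∈ Finset.range t, μ.real {ω | U (i, s) ω < N.rejectProb r ord i s} :=
        measureReal_biUnion_finset_le _ _
    _ ≤ _ := Finset.sum_le_sum fun s _ =>
        measureReal_lt_le (hU _) (hlaw _) (rejectProb_nonneg i s)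

open scoped Classical in
/-- The probability that too many requests through `e` survive the random choices is at most
`1 / m`. -/
theorem measureReal_cap_lt_card_survives_le [IsProbabilityMeasure μ] (hm : 2 ≤ Fintype.card E)
    (hord : ∀ t, (ord t).Perm (r t).edges) (hU : ∀ p, Measurable (U p))
    (hlaw : ∀ p, μ.map (U p) = (volume : Measure ℝ).restrict (Set.Icc 0 1))
    (hind : iIndepFun U μ) (t : ℕ) (e : E) :
    μ.real {ω | N.cap e + 1 ≤ (((N.through r (Finset.range t) e).filter (N.IsLight r ord t)).filter
      fun i => ω ∈ {ω | N.Survives r ord (fun p => U p ω) t i}).card} ≤ 1 / Fintype.card E := by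
  set L := (N.through r (Finset.range t) e).filter (N.IsLight r ord t) with hL
  set q : ℕ → ℝ := fun i =>
    ∏ s ∈ Finset.range t, μ.real (U (i, s) ⁻¹' N.surviveSet r ord (i, s)) with hq
  set l := Real.log (Fintype.card E) with hl
  have hl2 : Real.log 2 ≤ l := log_two_le_log_card hm
  have hl0 : 0 < l := (Real.log_pos one_lt_two).trans_le hl2
  have hm0 : (0 : ℝ) < Fintype.card E := by exact_mod_cast (two_pos.trans_le hm)
  -- With at most `c_e` light requests the event is empty; otherwise the surplus over `c_e + 1` is a
  -- natural number `k`.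
  rcases le_or_gt L.card (N.cap e) with hcard | hcard
  · rw [show {ω | N.cap e + 1 ≤ (L.filter fun i =>
        ω ∈ {ω | N.Survives r ord (fun p => U p ω) t i}).card} = ∅ from
      Set.eq_empty_of_forall_notMem fun ω hω => by
        have h1 : N.cap e + 1 ≤ _ := hω
        exact absurd (h1.trans (Finset.card_filter_le _ _)) (by omega), measureReal_empty]
    positivity
  have hcher := two_pow_mul_measureReal_card_le (μ := μ) L _
    (fun i => measurableSet_survives (N := N) (r := r) (ord := ord) hU t i) q
    (fun A _ => measureReal_iInter_preimage_surviveSet hind A t) (N.cap e + 1)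
  set P := μ.real {ω | N.cap e + 1 ≤ (L.filter fun i =>
    ω ∈ {ω | N.Survives r ord (fun p => U p ω) t i}).card}
  have hfac : ∀ i ∈ L, 1 + q i ≤ 2 * Real.exp (-(3 / 8 * (4 * l * N.weights r ord t i))) := by
    intro i hi
    refine le_trans (add_le_add_right (prod_measureReal_surviveSet_le hU hlaw t i) 1) ?_
    exact one_add_exp_neg_le (by positivity)
      (four_mul_log_mul_weight_lt hm (Finset.mem_filter.1 hi).2).le
  -- The edge requirement in deficit form passes to the light requests, since dropping terms only
  -- decreases the deficit sum.
  have hsum : (L.card : ℝ) - N.cap e ≤ ∑ i ∈ L, (N.weights r ord t i : ℝ) := by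
    have h1 := (N.satisfied_iff r t e _).1 (N.satisfied_weights r ord hord t e)
    have h2 : ∑ i ∈ L, (1 - N.weights r ord t i) ≤ (N.cap e : ℝ≥0) :=
      (Finset.sum_le_sum_of_subset (Finset.filter_subset _ _)).trans h1
    have h3 : ∑ i ∈ L, (1 - (N.weights r ord t i : ℝ)) ≤ N.cap e := by
      rw [← NNReal.coe_le_coe, NNReal.coe_sum, NNReal.coe_natCast] at h2
      refine le_of_eq_of_le (Finset.sum_congr rfl fun i hi => ?_) h2
      rw [NNReal.coe_sub (weight_lt_one hm (Finset.mem_filter.1 hi).2).le, NNReal.coe_one]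
    rw [Finset.sum_sub_distrib] at h3
    simp only [Finset.sum_const, nsmul_eq_mul, mul_one] at h3
    linarith
  -- The constant is `3/2 = 3/8 * 4`.
  have hprod : ∏ i ∈ L, (1 + q i) ≤ 2 ^ L.card * Real.exp (-(3 / 2 * l * (L.card - N.cap e))) := by
    refine (Finset.prod_le_prod (fun i _ => ?_) hfac).trans ?_
    · exact add_nonneg zero_le_one (Finset.prod_nonneg fun s _ => measureReal_nonneg)
    · rw [Finset.prod_mul_distrib, Finset.prod_const, ← Real.exp_sum]
      refine mul_le_mul_of_nonneg_left (Real.exp_le_exp.2 ?_) (by positivity)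
      rw [Finset.sum_neg_distrib, ← Finset.mul_sum, ← Finset.mul_sum]
      nlinarith
  obtain ⟨k, hk⟩ : ∃ k, L.card = N.cap e + 1 + k := Nat.exists_eq_add_of_le hcard
  have h4 : P ≤ 2 ^ k * Real.exp (-(3 / 2 * l * (k + 1))) := by
    have h5 := hcher.trans hprod
    rw [hk, pow_add _ (N.cap e + 1) k, mul_assoc] at h5
    have h6 := le_of_mul_le_mul_left h5 (by positivity)
    rwa [show ((N.cap e + 1 + k : ℕ) : ℝ) - N.cap e = k + 1 by push_cast; ring] at h6
  refine h4.trans ?_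
  rw [one_div, ← Real.exp_log hm0, ← Real.exp_neg, ← Real.exp_log (two_pos (α := ℝ)),
    ← Real.exp_nat_mul, ← Real.exp_add, Real.exp_le_exp, ← hl]
  have hk0 : (0 : ℝ) ≤ k := k.cast_nonneg
  rw [Real.exp_log two_pos]
  -- Since `log 2 ≤ l`, the exponent `k log 2 - (3/2) l (k + 1)` is at most `-l`.
  nlinarith [mul_le_mul_of_nonneg_left hl2 hk0, mul_nonneg hk0 hl0.le]

open scoped Classical in
-- A union bound restricted to the edges already requested beyond capacity; summing over all edges
-- of the path would not give a bound in terms of the optimum.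
theorem measureReal_overflow_le [IsProbabilityMeasure μ] (hm : 2 ≤ Fintype.card E)
    (hord : ∀ t, (ord t).Perm (r t).edges) (hU : ∀ p, Measurable (U p))
    (hlaw : ∀ p, μ.map (U p) = (volume : Measure ℝ).restrict (Set.Icc 0 1))
    (hind : iIndepFun U μ) (t : ℕ) :
    μ.real {ω | N.Overflow r ord (fun p => U p ω) t} ≤
      ((Finset.univ.filter fun e => e ∈ (r t).edges ∧
        N.cap e < (N.through r (Finset.range (t + 1)) e).card).card : ℝ) / Fintype.card E := by
  set B := Finset.univ.filter fun e => e ∈ (r t).edges ∧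
    N.cap e < (N.through r (Finset.range (t + 1)) e).card
  set W : E → Set Ω := fun e => {ω | N.cap e + 1 ≤
    (((N.through r (Finset.range (t + 1)) e).filter (N.IsLight r ord (t + 1))).filter
      fun i => ω ∈ {ω | N.Survives r ord (fun p => U p ω) (t + 1) i}).card}
  calc μ.real {ω | N.Overflow r ord (fun p => U p ω) t}
      ≤ μ.real (⋃ e ∈ B, W e) := by
        refine measureReal_mono (fun ω hω => ?_) (measure_ne_top _ _)
        obtain ⟨e, he, hlt⟩ := hω
        have h := through_candidates_subset (N := N) (r := r) (ord := ord) (fun p => U p ω) t e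
        have hB : e ∈ B := Finset.mem_filter.2 ⟨Finset.mem_univ e, he, hlt.trans_le <|
          Finset.card_le_card <| h.trans <|
            (Finset.filter_subset _ _).trans (Finset.filter_subset _ _)⟩
        exact Set.mem_biUnion hB (Nat.succ_le_of_lt (hlt.trans_le (Finset.card_le_card h)))
    _ ≤ ∑ e ∈ B, μ.real (W e) := measureReal_biUnion_finset_le _ _
    _ ≤ ∑ e ∈ B, 1 / (Fintype.card E : ℝ) := Finset.sum_le_sum fun e _ =>
        measureReal_cap_lt_card_survives_le hm hord hU hlaw hind (t + 1) e
    _ = _ := by rw [Finset.sum_const, nsmul_eq_mul, mul_one_div]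

open scoped Classical in
theorem sum_measureReal_overflow_le [IsProbabilityMeasure μ] (hm : 2 ≤ Fintype.card E)
    (hord : ∀ t, (ord t).Perm (r t).edges) (hU : ∀ p, Measurable (U p))
    (hlaw : ∀ p, μ.map (U p) = (volume : Measure ℝ).restrict (Set.Icc 0 1))
    (hind : iIndepFun U μ) (T : ℕ) :
    ∑ t ∈ Finset.range T, μ.real {ω | N.Overflow r ord (fun p => U p ω) t} ≤ N.optCost r T := by
  have hm0 : (0 : ℝ) < Fintype.card E := by exact_mod_cast (two_pos.trans_le hm)
  refine (Finset.sum_le_sum fun t _ =>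
    measureReal_overflow_le hm hord hU hlaw hind t).trans ?_
  rw [← Finset.sum_div, div_le_iff₀ hm0, ← Nat.cast_sum, ← Nat.cast_mul, Nat.cast_le]
  -- Double counting of pairs (round, overloaded edge): each of the `m` edges occurs in at most
  -- `C_OPT` rounds, which cancels the factor `1 / m`.
  have hswap := Finset.sum_card_bipartiteAbove_eq_sum_card_bipartiteBelow (s := Finset.range T)
    (t := (Finset.univ : Finset E)) fun t e => e ∈ (r t).edges ∧
      N.cap e < (N.through r (Finset.range (t + 1)) e).card
  simp only [Finset.bipartiteAbove, Finset.bipartiteBelow] at hswap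
  rw [hswap, mul_comm]
  refine (Finset.sum_le_card_nsmul _ _ (N.optCost r T) fun e _ => ?_).trans_eq (smul_eq_mul _ _)
  rw [card_filter_cap_lt]
  exact N.card_through_sub_cap_le_optCost r T e

theorem measurableSet_mem_rejected (hU : ∀ p, Measurable (U p)) (T i : ℕ) :
    MeasurableSet {ω | i ∈ N.rejected r ord (fun p => U p ω) T} :=
  measurableSet_accepted hU T fun A => i ∈ Finset.range T \ A

open scoped Classical in
theorem card_rejected (u : ℕ × ℕ → ℝ) (T : ℕ) :
    ((N.rejected r ord u T).card : ℝ) =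
      ∑ i ∈ Finset.range T, if i ∈ N.rejected r ord u T then 1 else 0 := by
  rw [Finset.sum_boole, Finset.filter_mem_eq_inter]
  congr 2
  exact (Finset.inter_eq_right.2 Finset.sdiff_subset).symm

theorem measureReal_mem_rejected_le [IsFiniteMeasure μ] (T i : ℕ) :
    μ.real {ω | i ∈ N.rejected r ord (fun p => U p ω) T} ≤
      μ.real {_ω : Ω | ¬ N.IsLight r ord T i} +
        (μ.real {ω | ¬ N.Survives r ord (fun p => U p ω) T i} +
          μ.real {ω | N.Overflow r ord (fun p => U p ω) i}) := by
  refine le_trans (measureReal_mono (s₂ := {_ω : Ω | ¬ N.IsLight r ord T i} ∪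
      ({ω | ¬ N.Survives r ord (fun p => U p ω) T i} ∪
        {ω | N.Overflow r ord (fun p => U p ω) i})) (fun ω hω => of_mem_rejected hω)
    (measure_ne_top _ _)) ?_
  exact (measureReal_union_le _ _).trans (add_le_add_right (measureReal_union_le _ _) _)

/-- The event is deterministic; when it occurs, the right-hand side is at least `1`. -/
theorem measureReal_not_isLight_le [IsProbabilityMeasure μ] (hm : 2 ≤ Fintype.card E) (T i : ℕ) :
    μ.real {_ω : Ω | ¬ N.IsLight r ord T i} ≤
      4 * Real.log (Fintype.card E) * N.weights r ord T i := by
  have hl0 : 0 < Real.log (Fintype.card E) :=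
    (Real.log_pos one_lt_two).trans_le (log_two_le_log_card hm)
  by_cases h : N.IsLight r ord T i
  · simp only [h, not_true_eq_false]
    refine le_of_eq_of_le measureReal_empty (by positivity)
  · refine measureReal_le_one.trans ?_
    rw [IsLight, not_lt, div_le_iff₀ (by positivity)] at h
    linarith

end Expectation

end Network

end AdmissionControl

/-! ### The competitive ratio -/

theorem theorem3p2 :
    ∃ K : ℝ, 0 < K ∧
      ∀ (V : Type*) (E : Type*) [Fintype E] (N : AdmissionControl.Network V E),
        2 ≤ Fintype.card E →
      ∀ (r : ℕ → N.SimplePath) (ord : ℕ → List E), (∀ t, (ord t).Perm (r t).edges) →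
      ∀ (Ω : Type*) [MeasurableSpace Ω] (μ : Measure Ω) [IsProbabilityMeasure μ]
        (U : ℕ × ℕ → Ω → ℝ), (∀ p, Measurable (U p)) →
        (∀ p, μ.map (U p) = (volume : Measure ℝ).restrict (Set.Icc 0 1)) → iIndepFun U μ →
      ∀ T : ℕ,
        (∀ ω, N.Feasible r (N.accepted r ord (fun p => U p ω) T) ∧
          N.rejected r ord (fun p => U p ω) T ⊆ N.rejected r ord (fun p => U p ω) (T + 1)) ∧
        Integrable (fun ω => ((N.rejected r ord (fun p => U p ω) T).card : ℝ)) μ ∧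
        ∫ ω, ((N.rejected r ord (fun p => U p ω) T).card : ℝ) ∂μ ≤
          K * Real.log (Fintype.card E) * Real.log (N.maxCap + 1) * N.optCost r T := by
  classical
  refine ⟨200, by norm_num, ?_⟩
  intro V E _ N hm r ord hord Ω _ μ _ U hU hlaw hind T
  have hint : ∀ i ∈ Finset.range T, Integrable
      ({ω | i ∈ N.rejected r ord (fun p => U p ω) T}.indicator (1 : Ω → ℝ)) μ := fun i _ =>
    (integrable_const 1).indicator (AdmissionControl.Network.measurableSet_mem_rejected hU T i)
  have hfun : (fun ω => ((N.rejected r ord (fun p => U p ω) T).card : ℝ)) = fun ω =>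
      ∑ i ∈ Finset.range T,
        {ω | i ∈ N.rejected r ord (fun p => U p ω) T}.indicator (1 : Ω → ℝ) ω := by
    ext ω
    simp only [AdmissionControl.Network.card_rejected, Set.indicator_apply, Set.mem_ofPred_eq,
      Pi.one_apply]
  refine ⟨fun ω => ⟨AdmissionControl.Network.feasible_accepted _ T,
    AdmissionControl.Network.rejected_subset_succ _ T⟩, ?_, ?_⟩
  · rw [hfun]
    exact integrable_finsetSum _ hint
  · rw [hfun, integral_finsetSum _ hint, Finset.sum_congr rfl fun i _ => integral_indicator_one
      (AdmissionControl.Network.measurableSet_mem_rejected hU T i)]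
    have : Nonempty E := Fintype.card_pos_iff.1 (two_pos.trans_le hm)
    have hfrac := AdmissionControl.Network.sum_weights_le ord hord T
    have hover := AdmissionControl.Network.sum_measureReal_overflow_le hm hord hU hlaw hind T
    have hl := AdmissionControl.Network.log_two_le_log_card hm
    have hc : Real.log 2 ≤ Real.log (N.maxCap + 1) := by
      obtain ⟨e⟩ := this
      have h1 : 1 ≤ N.maxCap := (N.cap_pos e).trans_le (N.cap_le_maxCap e)
      have h2 : (1 : ℝ) ≤ N.maxCap := by exact_mod_cast h1
      exact Real.log_le_log two_pos (by linarith)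
    -- The factor `8` is `4` for the weight threshold plus `4` for the random choices.
    have hbound : ∑ i ∈ Finset.range T, μ.real {ω | i ∈ N.rejected r ord (fun p => U p ω) T} ≤
        8 * Real.log (Fintype.card E) * ∑ i ∈ Finset.range T, (N.weights r ord T i : ℝ) +
          N.optCost r T := by
      rw [Finset.mul_sum]
      refine le_trans ?_ (add_le_add_right hover _)
      rw [← Finset.sum_add_distrib]
      refine Finset.sum_le_sum fun i _ => ?_
      have h1 := AdmissionControl.Network.measureReal_mem_rejected_le (μ := μ) (U := U)
        (N := N) (r := r) (ord := ord) T i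
      have h2 := AdmissionControl.Network.measureReal_not_isLight_le (μ := μ) (N := N) (r := r)
        (ord := ord) hm T i
      have h3 := AdmissionControl.Network.measureReal_not_survives_le (N := N) (r := r)
        (ord := ord) hU hlaw T i
      linarith
    refine hbound.trans ?_
    set a : ℝ := (N.optCost r T : ℝ)
    set l := Real.log (Fintype.card E)
    set b := Real.log (N.maxCap + 1)
    set F := ∑ i ∈ Finset.range T, (N.weights r ord T i : ℝ)
    have ha : 0 ≤ a := Nat.cast_nonneg _
    have hlog := Real.log_two_gt_d9
    -- `10 / log 2 < 15`.
    have hF : F ≤ 15 * b * a := by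
      have h0 : 0 ≤ b * a := mul_nonneg (by linarith) ha
      have h1 : 0 ≤ F := Finset.sum_nonneg fun i _ => NNReal.coe_nonneg _
      nlinarith
    -- `4 (log 2)² > 1`, which absorbs the lone term `C_OPT`; in total `8 * 15 + 4 = 124 ≤ 200`.
    have hlb : (1 : ℝ) ≤ 4 * (l * b) := by nlinarith
    have h1 : 8 * l * F ≤ 8 * l * (15 * b * a) :=
      mul_le_mul_of_nonneg_left hF (by linarith)
    have h2 : 1 * a ≤ 4 * (l * b) * a := mul_le_mul_of_nonneg_right hlb ha
    have h3 : 0 ≤ l * b * a := mul_nonneg (mul_nonneg (by linarith) (by linarith)) ha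
    linarith
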